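/- **Theorem.** All logarithms are to base 2. For finite sets $X, Y$ and a function $f : X\times Y\to\{0,1\}$, let $\mathrm{Qoip}_0(f)$ be the minimum number of queries made by a quantum algorithm that, for every $x\in X$, outputs $x$ with probability $1$ when it is given access to the unitary oracle $|y\rangle|a\rangle\mapsto|y\rangle|a+f(x,y) \bmod 2\rangle$ (and $\infty$ if there is no such algorithm). Let $\mathrm{Qcc}_0(f)$ be the minimum total number of qubits exchanged (in both directions together) in a protocol in which Alice holds $x\in X$, Bob holds $y\in Y$, the two share an entangled pure state of arbitrary finite dimension that does not depend on $(x,y)$, they apply local unitary operators and send qubits to each other, and for all $(x,y)$ Bob finally outputs $f(x,y)$ with probability $1$. There is an absolute constant $C$ such that for every finite set $X$ and every positive integer $q\le\log|X|$ there exist a finite set $Y$ and a function $f : X\times Y\to\{0,1\}$ such that $\mathrm{Qoip}_0(f)=q$ and $\mathrm{Qcc}_0(f)$ is finite with $$\mathrm{Qoip}_0(f)\cdot\mathrm{Qcc}_0(f)\;\le\;\tfrac12\log|X|+C\cdot\max(1,\;q\log q).$$ -/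

import Mathlib

universe u v

/-! Pure states of a register with finite computational basis `S` are amplitude vectors `S → ℂ`
of norm one, and unitary operators are elements of `Matrix.unitaryGroup S ℂ`. -/

/-- `ψ` is a pure state (a unit vector for the Euclidean norm). -/
def IsPureState {S : Type u} [Fintype S] (ψ : S → ℂ) : Prop :=
  ∑ s, ‖ψ s‖ ^ 2 = 1

/-! ### Oracle identification -/

/-- The unitary `|y⟩|a⟩|w⟩ ↦ |y⟩|a + f (x, y) mod k⟩|w⟩`, in terms of amplitudes (so that the new
amplitude at `(y, a, w)` is the old one at `(y, a - f (x, y), w)`; subtraction in `Fin k` is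
modulo `k`). -/
def oracleQuery {X : Type u} {Y : Type v} {k : ℕ} [NeZero k] {W : Type}
    (f : X × Y → Fin k) (x : X) (ψ : Y × Fin k × W → ℂ) : Y × Fin k × W → ℂ :=
  fun s => ψ (s.1, s.2.1 - f (x, s.1), s.2.2)

/-- A quantum query algorithm for identifying an element of `X`, with query registers `Y` and
`Fin k` and a finite workspace `W`. It starts in a fixed pure state, alternates oracle calls with
fixed unitary operators, finally measures all registers and computes its answer from the result. -/
structure QueryAlgorithm (X : Type u) (Y : Type v) [Fintype Y] [DecidableEq Y] (k : ℕ) where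
  /-- basis of the workspace -/
  W : Type
  [fintypeW : Fintype W]
  [decEqW : DecidableEq W]
  /-- the number of queries -/
  queries : ℕ
  /-- the state in which the first query is made -/
  init : Y × Fin k × W → ℂ
  init_isPureState : IsPureState init
  /-- `U i` is applied right after query number `i + 1` (only `i < queries` is relevant) -/
  U : ℕ → Matrix.unitaryGroup (Y × Fin k × W) ℂ
  /-- the answer computed from the outcome of the final measurement -/
  answer : Y × Fin k × W → X

namespace QueryAlgorithm

variable {X : Type u} {Y : Type v} [Fintype Y] [DecidableEq Y] {k : ℕ}

/-- The state after `i` queries (and the unitary that follows the last of them), when the unknown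
element is `x`. -/
def state [NeZero k] (A : QueryAlgorithm X Y k) (f : X × Y → Fin k) (x : X) :
    ℕ → (Y × Fin k × A.W → ℂ)
  | 0 => A.init
  | i + 1 =>
    letI := A.fintypeW
    letI := A.decEqW
    (A.U i : Matrix (Y × Fin k × A.W) (Y × Fin k × A.W) ℂ).mulVec
      (oracleQuery f x (A.state f x i))

/-- The probability that the algorithm answers `x` when the unknown element is `x`. -/
noncomputable def successProb [DecidableEq X] [NeZero k] (A : QueryAlgorithm X Y k)
    (f : X × Y → Fin k) (x : X) : ℝ :=
  letI := A.fintypeW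
  ∑ s : Y × Fin k × A.W, if A.answer s = x then ‖A.state f x A.queries s‖ ^ 2 else 0

end QueryAlgorithm

/-- The minimum number of queries with which a quantum algorithm identifies every `x`, given oracle
access to `y ↦ f (x, y)`, with failure probability at most `ε` (`⊤` if there is none). -/
noncomputable def Qoip {X : Type u} {Y : Type v} [DecidableEq X] [Fintype Y] [DecidableEq Y]
    {k : ℕ} [NeZero k] (ε : ℝ) (f : X × Y → Fin k) : ℕ∞ :=
  sInf {T : ℕ∞ | ∃ A : QueryAlgorithm X Y k,
    (A.queries : ℕ∞) = T ∧ ∀ x, 1 - ε ≤ A.successProb f x}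

/-! ### Communication over an entanglement-assisted two-way qubit channel -/

/-- The operator `M ⊗ 1` on a bipartite register. -/
def applyAlice {A B : Type} [Fintype A] (M : Matrix A A ℂ) (ψ : A × B → ℂ) : A × B → ℂ :=
  fun s => ∑ a, M s.1 a * ψ (a, s.2)

/-- The operator `1 ⊗ M` on a bipartite register. -/
def applyBob {A B : Type} [Fintype B] (M : Matrix B B ℂ) (ψ : A × B → ℂ) : A × B → ℂ :=
  fun s => ∑ b, M s.2 b * ψ (s.1, b)

/-- `CommProtocol X Y k A B` is the type of (remaining parts of) protocols in which Alice, with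
input in `X`, currently holds a register with basis `A`, and Bob, with input in `Y`, currently holds
a register with basis `B`; Bob outputs an element of `Fin k`. The players never measure before the
end, and ancillas are part of the registers. The direction and the length of the successive messages
are fixed by the protocol. -/
inductive CommProtocol (X : Type u) (Y : Type v) (k : ℕ) : Type → Type → Type (max 1 u v) where
  /-- Bob applies a unitary operator, measures his register, and outputs. -/
  | output {A B : Type} [Fintype A] [Fintype B] [DecidableEq B]
      (V : Y → Matrix.unitaryGroup B ℂ) (out : Y → B → Fin k) : CommProtocol X Y k A B
  /-- Alice applies a unitary operator to her register, then splits off `m` qubits and sends them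
  to Bob. -/
  | aliceSends {A B A' : Type} [Fintype A] [DecidableEq A] (m : ℕ)
      (U : X → Matrix.unitaryGroup A ℂ) (e : A ≃ A' × (Fin m → Bool))
      (rest : CommProtocol X Y k A' (B × (Fin m → Bool))) : CommProtocol X Y k A B
  /-- Bob applies a unitary operator to his register, then splits off `m` qubits and sends them
  to Alice. -/
  | bobSends {A B B' : Type} [Fintype B] [DecidableEq B] (m : ℕ)
      (V : Y → Matrix.unitaryGroup B ℂ) (e : B ≃ B' × (Fin m → Bool))
      (rest : CommProtocol X Y k (A × (Fin m → Bool)) B') : CommProtocol X Y k A B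

namespace CommProtocol

variable {X : Type u} {Y : Type v} {k : ℕ}

/-- The total number of qubits exchanged, in both directions. -/
def cost {A B : Type} : CommProtocol X Y k A B → ℕ
  | output _ _ => 0
  | aliceSends m _ _ rest => m + rest.cost
  | bobSends m _ _ rest => m + rest.cost

/-- The probability that Bob outputs `z` on inputs `x` and `y`, if the joint state of the two
players' registers is `ψ`. -/
noncomputable def outputProb (x : X) (y : Y) (z : Fin k) {A B : Type} :
    CommProtocol X Y k A B → (A × B → ℂ) → ℝ
  | output (A := A) (B := B) V out, ψ =>
    ∑ s : A × B, if out y s.2 = z then ‖applyBob (V y : Matrix B B ℂ) ψ s‖ ^ 2 else 0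
  | aliceSends (A := A) _ U e rest, ψ =>
    rest.outputProb x y z
      (fun s => applyAlice (U x : Matrix A A ℂ) ψ (e.symm (s.1, s.2.2), s.2.1))
  | bobSends (B := B) _ V e rest, ψ =>
    rest.outputProb x y z
      (fun s => applyBob (V y : Matrix B B ℂ) ψ (s.1.1, e.symm (s.2, s.1.2)))

end CommProtocol

/-- The minimum number of qubits exchanged in a protocol that computes `f` with failure probability
at most `ε`, where the players may share an arbitrary pure state `φ` of finite dimension, which does
not depend on the inputs (`⊤` if there is no such protocol). -/
noncomputable def Qcc {X : Type u} {Y : Type v} {k : ℕ} (ε : ℝ) (f : X × Y → Fin k) : ℕ∞ :=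
  sInf {c : ℕ∞ | ∃ (A B : Type) (_ : Fintype A) (_ : Fintype B) (φ : A × B → ℂ)
    (P : CommProtocol X Y k A B), IsPureState φ ∧ (P.cost : ℕ∞) = c ∧
      ∀ x y, 1 - ε ≤ P.outputProb x y (f (x, y)) φ}

open Finset

/-! Encode `X` injectively as sequences of `q` blocks of `2n` bits, with `n = ⌈log |X| / (2q)⌉`, and
let `f (x, (i, y))` be the parity of block `i` of `x` against the mask `y`. Bernstein-Vazirani reads
a whole block with one query, so `q` queries suffice (`Qoip_blockParity_le`). Since `2 ^ q ≤ |X|`,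
the encoding can be chosen so that its image contains a `q`-dimensional cube with one free bit per
block. On this cube a query reveals at most one bit, so amplitudes after `T` queries have degree at
most `T`. Exact identification needs an amplitude supported on a single point of the cube, which has
degree `q` (`le_Qoip_of_cube`). For communication, Bob sends the block index and Alice
superdense-codes that block into `n` qubits (`Qcc_blockParity_le`). The product is then at most `q *
n + q * ⌈log q⌉`, where the factor 1/2 is the gain from superdense coding. -/

/-! ### Norm preservation and certainty of the answer -/

theorem sum_norm_sq_mulVec {S : Type*} [Fintype S] [DecidableEq S]
    (U : Matrix.unitaryGroup S ℂ) (ψ : S → ℂ) :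
    ∑ s, ‖(U : Matrix S S ℂ).mulVec ψ s‖ ^ 2 = ∑ s, ‖ψ s‖ ^ 2 := by
  have key (φ : S → ℂ) : ((∑ s, ‖φ s‖ ^ 2 : ℝ) : ℂ) = star φ ⬝ᵥ φ := by
    simp [dotProduct, Complex.conj_mul']
  have h : star ((U : Matrix S S ℂ).mulVec ψ) ⬝ᵥ (U : Matrix S S ℂ).mulVec ψ = star ψ ⬝ᵥ ψ := by
    rw [Matrix.star_mulVec, ← Matrix.dotProduct_mulVec, Matrix.mulVec_mulVec,
      ← Matrix.star_eq_conjTranspose, Matrix.UnitaryGroup.star_mul_self, Matrix.one_mulVec]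
  rw [← key, ← key] at h
  exact_mod_cast h

theorem sum_norm_sq_oracleQuery {X : Type u} {Y : Type v} [Fintype Y] {k : ℕ} [NeZero k]
    {W : Type} [Fintype W] (f : X × Y → Fin k) (x : X) (ψ : Y × Fin k × W → ℂ) :
    ∑ s, ‖oracleQuery f x ψ s‖ ^ 2 = ∑ s, ‖ψ s‖ ^ 2 := by
  simp only [Fintype.sum_prod_type, oracleQuery]
  refine sum_congr rfl fun y _ => ?_
  exact (Equiv.subRight (f (x, y))).sum_comp fun a => ∑ w, ‖ψ (y, a, w)‖ ^ 2

theorem QueryAlgorithm.state_isPureState {X : Type u} {Y : Type v} [Fintype Y] [DecidableEq Y]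
    {k : ℕ} [NeZero k] (A : QueryAlgorithm X Y k) (f : X × Y → Fin k) (x : X) (i : ℕ) :
    let := A.fintypeW
    IsPureState (A.state f x i) := by
  let := A.fintypeW
  let := A.decEqW
  induction i with
  | zero => exact A.init_isPureState
  | succ i ih =>
    show ∑ s, _ = (1 : ℝ)
    exact (sum_norm_sq_mulVec (A.U i) _).trans ((sum_norm_sq_oracleQuery f x _).trans ih)

/-- A query algorithm is certain to answer `x` iff its final state is supported on the outcomes
for which the answer is `x`. -/
theorem QueryAlgorithm.one_le_successProb_iff {X : Type u} {Y : Type v} [DecidableEq X]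
    [Fintype Y] [DecidableEq Y] {k : ℕ} [NeZero k] (A : QueryAlgorithm X Y k)
    (f : X × Y → Fin k) (x : X) :
    1 ≤ A.successProb f x ↔ ∀ s, A.state f x A.queries s ≠ 0 → A.answer s = x := by
  let := A.fintypeW
  have h1 : ∑ s, ‖A.state f x A.queries s‖ ^ 2 = 1 := A.state_isPureState f x A.queries
  have hdiff : 1 - A.successProb f x =
      ∑ s, if A.answer s = x then 0 else ‖A.state f x A.queries s‖ ^ 2 := by
    rw [← h1, QueryAlgorithm.successProb, ← sum_sub_distrib]
    refine sum_congr rfl fun s _ => ?_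
    split_ifs <;> simp
  have hnonneg (s) : 0 ≤ if A.answer s = x then 0 else ‖A.state f x A.queries s‖ ^ 2 := by
    split_ifs <;> positivity
  constructor
  · intro h s hs
    have h0 : (∑ s, if A.answer s = x then 0 else ‖A.state f x A.queries s‖ ^ 2) = 0 :=
      le_antisymm (by linarith) (sum_nonneg fun s _ => hnonneg s)
    rw [sum_eq_zero_iff_of_nonneg fun s _ => hnonneg s] at h0
    by_contra hne
    have := h0 s (mem_univ s)
    rw [if_neg hne] at this
    exact hs (by simpa using this)
  · intro h
    rw [sum_eq_zero fun s _ => ?_] at hdiff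
    · linarith
    · split_ifs with hs
      · rfl
      · by_contra hne
        exact hs (h s fun h0 => hne (by simp [h0]))

/-! ### Lower bound for exact oracle identification -/

/-- The Fourier character of the cube `Fin q → Bool` given by the coordinates in `S`. -/
def cubeChar {q : ℕ} (S : Finset (Fin q)) (b : Fin q → Bool) : ℂ :=
  ∏ i ∈ S, if b i then -1 else 1

/-- Multiplying by the sign of bit `i` toggles `i` in `S`. This is why one query raises the degree
by at most one. -/
theorem cubeChar_mul_sign {q : ℕ} (S : Finset (Fin q)) (i : Fin q) :
    ∃ S' : Finset (Fin q), #S ≤ #S' + 1 ∧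
      ∀ b, cubeChar S b * (if b i then -1 else 1) = cubeChar S' b := by
  by_cases hi : i ∈ S
  · refine ⟨S.erase i, by rw [card_erase_add_one hi], fun b => ?_⟩
    rw [cubeChar, ← prod_erase_mul S _ hi, mul_assoc]
    cases b i <;> simp [cubeChar]
  · refine ⟨insert i S, by rw [card_insert_of_notMem hi]; omega, fun b => ?_⟩
    rw [cubeChar, cubeChar, prod_insert hi, mul_comm]

theorem cubeChar_ne_zero {q : ℕ} (S : Finset (Fin q)) (b : Fin q → Bool) : cubeChar S b ≠ 0 := by
  refine prod_ne_zero_iff.2 fun i _ => ?_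
  split_ifs <;> simp

/-- If every query reveals at most one bit of the point `b` of a cube, then the amplitudes after
`T` queries have degree at most `T` as functions of `b`. -/
theorem sum_cubeChar_mul_state {X : Type u} {Y : Type v} [Fintype Y] [DecidableEq Y] {q : ℕ}
    (f : X × Y → Fin 2) (c : (Fin q → Bool) → X)
    (hf : ∀ y, (∃ i, ∀ b, f (c b, y) = if b i then 1 else 0) ∨ ∀ b, f (c b, y) = 0)
    (A : QueryAlgorithm X Y 2) (T : ℕ) (S : Finset (Fin q)) (hS : T < #S) (s) :
    ∑ b, cubeChar S b * A.state f (c b) T s = 0 := by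
  let := A.fintypeW
  let := A.decEqW
  induction T generalizing S s with
  | zero =>
    simp only [QueryAlgorithm.state]
    rw [← sum_mul]
    have h : ∑ b : Fin q → Bool, cubeChar S b = 0 := by
      have h1 (b : Fin q → Bool) : cubeChar S b = ∏ i, if i ∈ S then (if b i then -1 else 1) else 1 := by
        rw [cubeChar, prod_ite_mem, univ_inter]
      obtain ⟨i, hi⟩ := card_pos.1 hS
      have h2 := Finset.prod_univ_sum (fun _ : Fin q => (univ : Finset Bool))
        (fun i β => if i ∈ S then (if β then (-1 : ℂ) else 1) else 1)
      rw [Fintype.piFinset_univ] at h2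
      rw [sum_congr rfl fun b _ => h1 b, ← h2]
      exact prod_eq_zero (mem_univ i) (by simp [hi])
    rw [h, zero_mul]
  | succ T ih =>
    have horacle (t : Y × Fin 2 × A.W) :
        ∑ b, cubeChar S b * oracleQuery f (c b) (A.state f (c b) T) t = 0 := by
      obtain ⟨y, a, w⟩ := t
      rcases hf y with ⟨i, hi⟩ | h0
      · obtain ⟨S', hcard, hS'⟩ := cubeChar_mul_sign S i
        -- With `σ` the sign of bit `i`, the queried amplitude is `(1 + σ) / 2` times the old one
        -- plus `(1 - σ) / 2` times the shifted one.
        have hsplit (b : Fin q → Bool) :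
            cubeChar S b * oracleQuery f (c b) (A.state f (c b) T) (y, a, w) =
              (cubeChar S b * A.state f (c b) T (y, a, w)
                + cubeChar S b * A.state f (c b) T (y, a - 1, w)
                + cubeChar S' b * A.state f (c b) T (y, a, w)
                - cubeChar S' b * A.state f (c b) T (y, a - 1, w)) / 2 := by
          rw [← hS', oracleQuery, hi]
          cases b i <;> simp <;> ring
        simp_rw [hsplit]
        rw [← sum_div, sum_sub_distrib, sum_add_distrib, sum_add_distrib,
          ih S (by omega), ih S (by omega), ih S' (by omega), ih S' (by omega)]
        simp
      · have := ih S (by omega) (y, a, w)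
        simpa [oracleQuery, h0] using this
    have hlin : ∑ b, cubeChar S b * A.state f (c b) (T + 1) s =
        ∑ t, (A.U T : Matrix _ _ ℂ) s t *
          ∑ b, cubeChar S b * oracleQuery f (c b) (A.state f (c b) T) t := by
      simp only [QueryAlgorithm.state, Matrix.mulVec, dotProduct, mul_sum]
      rw [sum_comm]
      exact sum_congr rfl fun t _ => sum_congr rfl fun b _ => by ring
    rw [hlin]
    exact sum_eq_zero fun t _ => by rw [horacle, mul_zero]

/-- With fewer than `q` queries the top Fourier coefficient of every final amplitude vanishes.
Exactness leaves only one nonzero term in that coefficient, a contradiction. -/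
theorem le_Qoip_of_cube {X : Type u} {Y : Type v} [DecidableEq X] [Fintype Y] [DecidableEq Y]
    {q : ℕ} (f : X × Y → Fin 2) (c : (Fin q → Bool) → X) (hc : Function.Injective c)
    (hf : ∀ y, (∃ i, ∀ b, f (c b, y) = if b i then 1 else 0) ∨ ∀ b, f (c b, y) = 0) :
    (q : ℕ∞) ≤ Qoip 0 f := by
  refine le_sInf ?_
  rintro T ⟨A, rfl, hA⟩
  let := A.fintypeW
  simp only [sub_zero, A.one_le_successProb_iff] at hA
  by_contra! hlt
  have hlt : A.queries < q := by exact_mod_cast hlt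
  let b₀ : Fin q → Bool := fun _ => false
  have hpure : ∑ s, ‖A.state f (c b₀) A.queries s‖ ^ 2 = 1 :=
    A.state_isPureState f (c b₀) A.queries
  obtain ⟨s, hs⟩ : ∃ s, A.state f (c b₀) A.queries s ≠ 0 := by
    by_contra! h
    simp [h] at hpure
  have hsum := sum_cubeChar_mul_state f c hf A A.queries univ (by simpa using hlt) s
  -- The outcome `s` has a single answer, so its amplitude is nonzero for no other point of the
  -- cube.
  rw [Fintype.sum_eq_single b₀ fun b hb => ?_] at hsum
  · exact (mul_ne_zero (cubeChar_ne_zero _ _) hs) hsum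
  · by_contra hne
    exact hb (hc ((hA (c b) s (right_ne_zero_of_mul hne)).symm.trans (hA (c b₀) s hs)))

/-! ### Monomial and controlled unitary operators -/

/-- The unitary operator that turns the amplitudes `ψ s` into `c s * ψ (σ s)`. -/
def monomialUnitary {S : Type*} [Fintype S] [DecidableEq S] (σ : Equiv.Perm S) (c : S → ℂ)
    (hc : ∀ s, c s * star (c s) = 1) : Matrix.unitaryGroup S ℂ :=
  ⟨Matrix.of fun s t => if t = σ s then c s else 0, by
    rw [Matrix.mem_unitaryGroup_iff]
    ext s t
    rw [Matrix.mul_apply, Fintype.sum_eq_single (σ s) fun r hr => by simp [hr]]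
    rcases eq_or_ne s t with rfl | hst
    · simpa using hc s
    · simp [hst]⟩

theorem monomialUnitary_mulVec {S : Type*} [Fintype S] [DecidableEq S] (σ : Equiv.Perm S)
    (c : S → ℂ) (hc : ∀ s, c s * star (c s) = 1) (ψ : S → ℂ) (s : S) :
    (monomialUnitary σ c hc : Matrix S S ℂ).mulVec ψ s = c s * ψ (σ s) := by
  simp [monomialUnitary, Matrix.mulVec, dotProduct]

/-- The permutation `σ` of the basis states as a unitary operator. -/
def permUnitary {S : Type*} [Fintype S] [DecidableEq S] (σ : Equiv.Perm S) :
    Matrix.unitaryGroup S ℂ :=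
  monomialUnitary σ (fun _ => 1) (by simp)

theorem permUnitary_mulVec {S : Type*} [Fintype S] [DecidableEq S] (σ : Equiv.Perm S)
    (ψ : S → ℂ) (s : S) : (permUnitary σ : Matrix S S ℂ).mulVec ψ s = ψ (σ s) := by
  rw [permUnitary, monomialUnitary_mulVec, one_mul]

/-- The operator `M` acting on the tensor factor `B` of `S ≃ B × C`. -/
def factorUnitary {S B C : Type*} [Fintype S] [DecidableEq S] [Fintype B] [DecidableEq B]
    [Fintype C] [DecidableEq C] (e : S ≃ B × C) (M : Matrix.unitaryGroup B ℂ) :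
    Matrix.unitaryGroup S ℂ :=
  ⟨Matrix.of fun s t => if (e t).2 = (e s).2 then (M : Matrix B B ℂ) (e s).1 (e t).1 else 0, by
    rw [Matrix.mem_unitaryGroup_iff]
    ext s t
    have hM := congrFun₂ (Matrix.mem_unitaryGroup_iff.1 M.2) (e s).1 (e t).1
    rw [Matrix.mul_apply] at hM
    rw [Matrix.mul_apply, ← e.symm.sum_comp, Fintype.sum_prod_type]
    simp only [Equiv.apply_symm_apply, Matrix.star_apply, Matrix.of_apply, ite_mul, zero_mul,
      sum_ite_eq', mem_univ, if_true] at hM ⊢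
    rcases eq_or_ne s t with rfl | hst
    · simpa using hM
    · by_cases h2 : (e s).2 = (e t).2
      · have h1 : (e s).1 ≠ (e t).1 := fun h1 => hst (e.injective (Prod.ext h1 h2))
        simpa [h2, hst, h1] using hM
      · simp [h2, hst]⟩

theorem factorUnitary_mulVec {S B C : Type*} [Fintype S] [DecidableEq S] [Fintype B]
    [DecidableEq B] [Fintype C] [DecidableEq C] (e : S ≃ B × C) (M : Matrix.unitaryGroup B ℂ)
    (ψ : S → ℂ) (s : S) :
    (factorUnitary e M : Matrix S S ℂ).mulVec ψ s =
      ∑ b, (M : Matrix B B ℂ) (e s).1 b * ψ (e.symm (b, (e s).2)) := by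
  rw [Matrix.mulVec, dotProduct, ← e.symm.sum_comp, Fintype.sum_prod_type]
  simp [factorUnitary]

/-! ### Parity functions and the Walsh-Hadamard transform -/

/-- The inner product modulo 2 of two bit strings. -/
def bitDot {ι : Type*} [Fintype ι] (x y : ι → Bool) : Fin 2 :=
  ∑ k, if x k && y k then 1 else 0

/-- The sign `(-1) ^ a`. -/
def bitSign (a : Fin 2) : ℂ := if a = 0 then 1 else -1

theorem bitSign_add (a b : Fin 2) : bitSign (a + b) = bitSign a * bitSign b := by
  fin_cases a <;> fin_cases b <;> simp [bitSign]

theorem bitSign_sub (a b : Fin 2) : bitSign (a - b) = bitSign a * bitSign b := by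
  fin_cases a <;> fin_cases b <;> simp [bitSign]

theorem bitSign_mul_star (a : Fin 2) : bitSign a * star (bitSign a) = 1 := by
  fin_cases a <;> simp [bitSign]

theorem norm_bitSign (a : Fin 2) : ‖bitSign a‖ = 1 := by
  fin_cases a <;> simp [bitSign]

theorem bitSign_bitDot {ι : Type*} [Fintype ι] (x y : ι → Bool) :
    bitSign (bitDot x y) = ∏ k, if x k && y k then -1 else 1 := by
  have h (s : Finset ι) : bitSign (∑ k ∈ s, if x k && y k then 1 else 0) =
      ∏ k ∈ s, if x k && y k then -1 else 1 := by
    classical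
    induction s using Finset.induction_on with
    | empty => simp [bitSign]
    | insert k s hk ih =>
      rw [sum_insert hk, prod_insert hk, bitSign_add, ih]
      congr 1
      split_ifs <;> simp [bitSign]
  exact h univ

theorem bitDot_comm {ι : Type*} [Fintype ι] (x y : ι → Bool) : bitDot x y = bitDot y x := by
  simp [bitDot, Bool.and_comm]

/-- The amplitudes `2 ^ (-|ι| / 2)` of the uniform superposition of all bit strings. -/
noncomputable def uniformAmp (ι : Type*) [Fintype ι] : ℂ :=
  (((√2)⁻¹ : ℝ) : ℂ) ^ Fintype.card ι

theorem uniformAmp_mul_self (ι : Type*) [Fintype ι] :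
    uniformAmp ι * uniformAmp ι * 2 ^ Fintype.card ι = 1 := by
  rw [uniformAmp, ← mul_pow, ← mul_pow, ← Complex.ofReal_mul, ← mul_inv,
    Real.mul_self_sqrt zero_le_two]
  simp

theorem norm_uniformAmp_sq (ι : Type*) [Fintype ι] :
    2 ^ Fintype.card ι * ‖uniformAmp ι‖ ^ 2 = 1 := by
  have h := congrArg norm (uniformAmp_mul_self ι)
  rw [norm_mul, norm_mul, norm_pow, Complex.norm_two, norm_one] at h
  linarith

/-- The sum factors over coordinates, and a coordinate where `x` and `z` differ contributes `1 - 1 =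
0`. -/
theorem sum_bitSign_bitDot {ι : Type*} [Fintype ι] [DecidableEq ι] (x z : ι → Bool) :
    ∑ y, bitSign (bitDot x y) * bitSign (bitDot y z) =
      if x = z then 2 ^ Fintype.card ι else 0 := by
  have h := Finset.prod_univ_sum (fun _ : ι => (univ : Finset Bool))
    (fun k β => (if x k && β then (-1 : ℂ) else 1) * if β && z k then -1 else 1)
  rw [Fintype.piFinset_univ] at h
  simp only [bitSign_bitDot, ← prod_mul_distrib]
  rw [← h]
  split_ifs with hxz
  · subst hxz
    rw [← Finset.card_univ, ← prod_const]
    refine prod_congr rfl fun k _ => ?_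
    cases x k <;> norm_num
  · obtain ⟨k, hk⟩ := Function.ne_iff.1 hxz
    refine prod_eq_zero (mem_univ k) ?_
    revert hk
    cases x k <;> cases z k <;> simp

/-- The Walsh-Hadamard transform. -/
noncomputable def hadamard (ι : Type*) [Fintype ι] [DecidableEq ι] :
    Matrix.unitaryGroup (ι → Bool) ℂ :=
  ⟨Matrix.of fun x y => uniformAmp ι * bitSign (bitDot x y), by
    rw [Matrix.mem_unitaryGroup_iff]
    ext x z
    rw [Matrix.mul_apply]
    have h (y : ι → Bool) : uniformAmp ι * bitSign (bitDot x y) *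
        star (uniformAmp ι * bitSign (bitDot z y)) =
          uniformAmp ι * uniformAmp ι * (bitSign (bitDot x y) * bitSign (bitDot y z)) := by
      have h1 : star (uniformAmp ι) = uniformAmp ι := by simp [uniformAmp]
      have h2 (a : Fin 2) : star (bitSign a) = bitSign a := by
        rw [bitSign]; split_ifs <;> simp
      rw [star_mul, h1, h2, bitDot_comm z]
      ring
    simp only [Matrix.star_apply, Matrix.of_apply, h]
    rw [← mul_sum, sum_bitSign_bitDot, Matrix.one_apply]
    split_ifs
    · exact uniformAmp_mul_self ι
    · simp⟩

theorem hadamard_apply {ι : Type*} [Fintype ι] [DecidableEq ι] (x y : ι → Bool) :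
    (hadamard ι : Matrix (ι → Bool) (ι → Bool) ℂ) x y = uniformAmp ι * bitSign (bitDot x y) :=
  rfl

theorem hadamard_apply_zero {ι : Type*} [Fintype ι] [DecidableEq ι] (x : ι → Bool) :
    (hadamard ι : Matrix (ι → Bool) (ι → Bool) ℂ) x (fun _ => false) = uniformAmp ι := by
  simp [hadamard_apply, bitDot, bitSign]

/-- The Walsh-Hadamard transform turns a phase `(-1) ^ (x ⬝ y)` into the basis state `x`. -/
theorem sum_hadamard_mul_bitSign {ι : Type*} [Fintype ι] [DecidableEq ι] (x z : ι → Bool) :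
    ∑ y, (hadamard ι : Matrix (ι → Bool) (ι → Bool) ℂ) z y *
      (uniformAmp ι * bitSign (bitDot x y)) = if z = x then 1 else 0 := by
  have h (y : ι → Bool) : uniformAmp ι * bitSign (bitDot z y) *
      (uniformAmp ι * bitSign (bitDot x y)) =
        uniformAmp ι * uniformAmp ι * (bitSign (bitDot z y) * bitSign (bitDot y x)) := by
    rw [bitDot_comm x]
    ring
  simp only [hadamard_apply, h]
  rw [← mul_sum, sum_bitSign_bitDot]
  split_ifs
  · exact uniformAmp_mul_self ι
  · simp

/-- The function of `x` and `(i, y)` that gives the parity `E x i ⬝ y`, where `E` encodes `x` as a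
sequence of `q` bit strings. -/
def blockParity {X : Type u} {ι : Type} [Fintype ι] {q : ℕ} (E : X → Fin q → ι → Bool) :
    X × (Fin q × (ι → Bool)) → Fin 2 :=
  fun s => bitDot (E s.1 s.2.1) s.2.2

/-! ### Identification by the Bernstein-Vazirani algorithm, one block per query -/

section BernsteinVazirani

variable {q : ℕ} [NeZero q] {ι : Type}

/-- Swap the bit string of the query register with the memory cell given by the index in the query
register, and increase this index (here given as the inverse). -/
def swapAndStep : Equiv.Perm ((Fin q × (ι → Bool)) × Fin 2 × (Fin q → ι → Bool)) where
  toFun s := ((s.1.1 - 1, s.2.2 (s.1.1 - 1)), s.2.1,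
    Function.update s.2.2 (s.1.1 - 1) s.1.2)
  invFun s := ((s.1.1 + 1, s.2.2 s.1.1), s.2.1, Function.update s.2.2 s.1.1 s.1.2)
  left_inv s := by simp
  right_inv s := by simp

/-- The bit string of the query register, separated from the other registers. -/
def queryBits : (Fin q × (ι → Bool)) × Fin 2 × (Fin q → ι → Bool) ≃
    (ι → Bool) × (Fin q × Fin 2 × (Fin q → ι → Bool)) where
  toFun s := (s.1.2, s.1.1, s.2)
  invFun s := ((s.2.1, s.1), s.2.2)
  left_inv _ := rfl
  right_inv _ := rfl

/-- The first `i` blocks of `x`, followed by zeros. -/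
def blockPrefix (x : Fin q → ι → Bool) (i : ℕ) : Fin q → ι → Bool :=
  fun j => if (j : ℕ) < i then x j else fun _ => false

/-- Tracks the support through the swap: the block just read enters cell `i`, and the blank content
of that cell returns to the query register. The index is cyclic, so the last step harmlessly returns
to 0. -/
theorem swapAndStep_iff (x : Fin q → ι → Bool) {i : ℕ} (hi : i < q) (j : Fin q) (z : ι → Bool)
    (w : Fin q → ι → Bool) :
    ((j - 1 = Fin.ofNat q i ∧ Function.update w (j - 1) z = blockPrefix x i) ∧
        w (j - 1) = x (Fin.ofNat q i)) ↔
      (j = Fin.ofNat q (i + 1) ∧ w = blockPrefix x (i + 1)) ∧ z = fun _ => false := by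
  have hval : (Fin.ofNat q i : ℕ) = i := Nat.mod_eq_of_lt hi
  have hsucc : (Fin.ofNat q (i + 1)) = Fin.ofNat q i + 1 := by
    ext; simp [Fin.val_add]
  rw [hsucc, sub_eq_iff_eq_add]
  set k := Fin.ofNat q i with hk
  constructor
  · rintro ⟨⟨rfl, hw⟩, hx⟩
    rw [add_sub_cancel_right] at hw hx
    refine ⟨⟨rfl, ?_⟩, ?_⟩
    · funext l
      rcases eq_or_ne l k with rfl | hl
      · simp [blockPrefix, hx, hval]
      · have := congrFun hw l
        rw [Function.update_of_ne hl] at this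
        have hne : (l : ℕ) ≠ i := fun h => hl (Fin.ext (h.trans hval.symm))
        rw [this, blockPrefix, blockPrefix]
        exact if_congr (by omega) rfl rfl
    · have := congrFun hw k
      simpa [blockPrefix, hval] using this
  · rintro ⟨⟨rfl, rfl⟩, rfl⟩
    rw [add_sub_cancel_right]
    refine ⟨⟨rfl, ?_⟩, ?_⟩
    · funext l
      rcases eq_or_ne l k with rfl | hl
      · simp [blockPrefix, hval]
      · have hne : (l : ℕ) ≠ i := fun h => hl (Fin.ext (h.trans hval.symm))
        rw [Function.update_of_ne hl, blockPrefix, blockPrefix]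
        exact if_congr (by omega) rfl rfl
    · simp [blockPrefix, hval]

variable [Fintype ι] [DecidableEq ι]

/-- The state of the Bernstein-Vazirani algorithm before query number `i + 1`. -/
noncomputable def bvState (x : Fin q → ι → Bool) (i : ℕ) :
    (Fin q × (ι → Bool)) × Fin 2 × (Fin q → ι → Bool) → ℂ :=
  fun s => if s.1.1 = Fin.ofNat q i ∧ s.2.2 = blockPrefix x i then
    uniformAmp ι * (uniformAmp Unit * bitSign s.2.1) else 0

theorem bvState_isPureState (x : Fin q → ι → Bool) (i : ℕ) : IsPureState (bvState x i) := by
  have h1 := norm_uniformAmp_sq ι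
  have h2 := norm_uniformAmp_sq Unit
  unfold IsPureState bvState
  generalize Fin.ofNat q i = k
  generalize blockPrefix x i = v
  simp only [Fintype.sum_prod_type]
  rw [Fintype.sum_eq_single k fun j hj => by simp [hj]]
  calc _ = ∑ _y : ι → Bool, ∑ _a : Fin 2, ‖uniformAmp ι‖ ^ 2 * ‖uniformAmp Unit‖ ^ 2 := by
        refine sum_congr rfl fun y _ => sum_congr rfl fun a _ => ?_
        rw [Fintype.sum_eq_single v fun w hw => by simp [hw]]
        simp [norm_bitSign, mul_pow]
    _ = 1 := by
        simp only [sum_const, card_univ, Fintype.card_fin, Fintype.card_fun, Fintype.card_bool,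
          nsmul_eq_mul]
        push_cast
        simp only [Fintype.card_unit, pow_one] at h2
        linear_combination h1 + 2 ^ Fintype.card ι * ‖uniformAmp ι‖ ^ 2 * h2

/-- The operator applied after each query of the Bernstein-Vazirani algorithm. -/
noncomputable def bvUnitary : Matrix.unitaryGroup
    ((Fin q × (ι → Bool)) × Fin 2 × (Fin q → ι → Bool)) ℂ :=
  factorUnitary queryBits (hadamard ι) * permUnitary swapAndStep *
    factorUnitary queryBits (hadamard ι)

/-- Phase kickback: the answer qubit is in the state `|0⟩ - |1⟩` up to scale, so the query only
multiplies by the sign of the parity. The first Hadamard transform turns these signs into the block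
itself, which is then swapped into memory. -/
theorem bvUnitary_mulVec {X : Type u} (E : X → Fin q → ι → Bool) (x : X) {i : ℕ} (hi : i < q) :
    (bvUnitary : Matrix.unitaryGroup _ ℂ).1.mulVec
      (oracleQuery (blockParity E) x (bvState (E x) i)) = bvState (E x) (i + 1) := by
  have h1 (s : (Fin q × (ι → Bool)) × Fin 2 × (Fin q → ι → Bool)) :
      (factorUnitary queryBits (hadamard ι)).1.mulVec
        (oracleQuery (blockParity E) x (bvState (E x) i)) s =
      if (s.1.1 = Fin.ofNat q i ∧ s.2.2 = blockPrefix (E x) i) ∧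
        s.1.2 = E x (Fin.ofNat q i) then uniformAmp Unit * bitSign s.2.1 else 0 := by
    rw [factorUnitary_mulVec]
    by_cases hs : s.1.1 = Fin.ofNat q i ∧ s.2.2 = blockPrefix (E x) i
    · have hterm (y : ι → Bool) : oracleQuery (blockParity E) x (bvState (E x) i)
          (queryBits.symm (y, (queryBits s).2)) =
            (uniformAmp Unit * bitSign s.2.1) *
              (uniformAmp ι * bitSign (bitDot (E x (Fin.ofNat q i)) y)) := by
        show (if s.1.1 = Fin.ofNat q i ∧ s.2.2 = blockPrefix (E x) i then uniformAmp ι *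
          (uniformAmp Unit * bitSign (s.2.1 - bitDot (E x s.1.1) y)) else 0) = _
        rw [if_pos hs, hs.1, bitSign_sub]
        ring
      simp only [hterm, mul_left_comm _ (uniformAmp Unit * bitSign s.2.1)]
      rw [← mul_sum, sum_hadamard_mul_bitSign]
      simp [hs, queryBits]
    · rw [if_neg fun h => hs h.1]
      refine sum_eq_zero fun y _ => ?_
      exact mul_eq_zero_of_right _ (if_neg hs)
  funext s
  obtain ⟨⟨j, y⟩, a, w⟩ := s
  rw [bvUnitary, Submonoid.coe_mul, Submonoid.coe_mul, ← Matrix.mulVec_mulVec,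
    ← Matrix.mulVec_mulVec, factorUnitary_mulVec]
  simp only [permUnitary_mulVec, h1]
  simp only [swapAndStep, queryBits, Equiv.coe_fn_mk, Equiv.coe_fn_symm_mk,
    swapAndStep_iff (E x) hi, bvState]
  -- The swap left the query bits blank, so the second Hadamard transform restores the uniform
  -- superposition.
  rw [Fintype.sum_eq_single (fun _ => false) fun z hz => by simp [hz], hadamard_apply_zero]
  split_ifs <;> simp_all

theorem Qoip_blockParity_le {X : Type u} [DecidableEq X] [Nonempty X]
    (E : X → Fin q → ι → Bool) (hE : Function.Injective E) :
    Qoip 0 (blockParity E) ≤ q := by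
  let A : QueryAlgorithm X (Fin q × (ι → Bool)) 2 :=
    { W := Fin q → ι → Bool
      queries := q
      -- The prefix of length 0 is blank whatever the string, so this is the initial `bvState` for
      -- every `x`.
      init := bvState (fun _ _ => false) 0
      init_isPureState := bvState_isPureState _ _
      U := fun _ => bvUnitary
      answer := fun s => Function.invFun E s.2.2 }
  have hstate (x : X) (i : ℕ) (hi : i ≤ q) : A.state (blockParity E) x i = bvState (E x) i := by
    induction i with
    | zero =>
      show bvState (fun _ _ => false) 0 = bvState (E x) 0
      funext s
      simp only [bvState, show blockPrefix (fun _ _ => false) 0 = blockPrefix (E x) 0 by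
        funext j; simp [blockPrefix]]
    | succ i ih =>
      rw [← bvUnitary_mulVec E x hi, ← ih (by omega)]
      rfl
  refine sInf_le ⟨A, rfl, fun x => ?_⟩
  rw [sub_zero, A.one_le_successProb_iff]
  intro s hs
  change A.state (blockParity E) x q s ≠ 0 at hs
  rw [hstate x q le_rfl, bvState] at hs
  have hw : s.2.2 = blockPrefix (E x) q := by
    by_contra h
    exact hs (if_neg fun h' => h h'.2)
  have hx : s.2.2 = E x := by rw [hw]; funext j; simp [blockPrefix]
  show Function.invFun E s.2.2 = x
  rw [hx, Function.leftInverse_invFun hE]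

end BernsteinVazirani

/-! ### Communication by superdense coding -/

/-- The bitwise sum modulo 2 of two bit strings. -/
def bitXor {κ : Type} (a b : κ → Bool) : κ → Bool := fun k => xor (a k) (b k)

theorem bitXor_bitXor {κ : Type} (a b : κ → Bool) : bitXor (bitXor a b) b = a := by
  funext k; simp [bitXor]

theorem bitXor_eq_iff {κ : Type} (a b c : κ → Bool) : bitXor a b = c ↔ a = bitXor c b :=
  ⟨fun h => by rw [← h, bitXor_bitXor], fun h => by rw [h, bitXor_bitXor]⟩

theorem bitXor_comm {κ : Type} (a b : κ → Bool) : bitXor a b = bitXor b a := by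
  funext k; simp [bitXor, Bool.xor_comm]

/-- Add to the first register a function of the second register. -/
def xorFst {κ μ : Type} (g : μ → κ → Bool) : Equiv.Perm ((κ → Bool) × μ) :=
  Function.Involutive.toPerm (fun s => (bitXor s.1 (g s.2), s.2)) fun s => by
    simp [bitXor_bitXor]

/-- Add to the second register a function of the first register. -/
def xorSnd {κ μ : Type} (g : μ → κ → Bool) : Equiv.Perm (μ × (κ → Bool)) :=
  Function.Involutive.toPerm (fun s => (s.1, bitXor s.2 (g s.1))) fun s => by
    simp [bitXor_bitXor]

theorem applyAlice_eq_mulVec {A B : Type} [Fintype A] (M : Matrix A A ℂ) (ψ : A × B → ℂ)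
    (s : A × B) : applyAlice M ψ s = M.mulVec (fun a => ψ (a, s.2)) s.1 := rfl

theorem applyBob_eq_mulVec {A B : Type} [Fintype B] (M : Matrix B B ℂ) (ψ : A × B → ℂ)
    (s : A × B) : applyBob M ψ s = M.mulVec (fun b => ψ (s.1, b)) s.2 := rfl

section Superdense

variable {X : Type u} {q n l : ℕ} (E : X → Fin q → Fin n ⊕ Fin n → Bool)
  (code : Fin q → Fin l → Bool) (dec : (Fin l → Bool) → Fin q)

/-- Bob sends the index of a block to Alice, who answers by a superdense coding of this block. -/
noncomputable def superdenseProtocol : CommProtocol X (Fin q × (Fin n ⊕ Fin n → Bool)) 2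
    (Fin n → Bool) ((Fin n → Bool) × (Fin l → Bool)) :=
  .bobSends (B' := Fin n → Bool) l
    (fun y => permUnitary (xorSnd fun _ => code y.1)) (Equiv.refl _) <|
  .aliceSends (A' := Fin l → Bool) n
    -- The Pauli operator: a phase by the left half of the block, then a shift by the right half,
    -- controlled on the received index, which Alice keeps.
    (fun x => monomialUnitary (xorFst fun m k => E x (dec m) (.inr k))
      (fun s => bitSign (bitDot (fun k => E x (dec s.2) (.inl k))
        (bitXor s.1 fun k => E x (dec s.2) (.inr k)))) fun _ => bitSign_mul_star _)
    (Equiv.prodComm _ _) <|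
  .output (fun _ => factorUnitary (Equiv.refl _) (hadamard (Fin n)) * permUnitary (xorSnd id))
    fun y s => bitDot (Sum.elim s.1 s.2) y.2

/-- Maximally entangled qubits, together with blank qubits on Bob's side. -/
noncomputable def sharedState (n l : ℕ) :
    (Fin n → Bool) × ((Fin n → Bool) × (Fin l → Bool)) → ℂ :=
  fun s => if s.2.1 = s.1 ∧ s.2.2 = fun _ => false then uniformAmp (Fin n) else 0

theorem sharedState_isPureState (n l : ℕ) : IsPureState (sharedState n l) := by
  have h1 := norm_uniformAmp_sq (Fin n)
  unfold IsPureState sharedState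
  simp only [Fintype.sum_prod_type]
  calc _ = ∑ _a : Fin n → Bool, ‖uniformAmp (Fin n)‖ ^ 2 := by
        refine sum_congr rfl fun a _ => ?_
        rw [Fintype.sum_eq_single a fun b hb => by simp [hb],
          Fintype.sum_eq_single (fun _ => false) fun m hm => by simp [hm]]
        simp
    _ = 1 := by simpa using h1

/-- Alice's operator produces one of the `4 ^ n` Bell states, labelled by the halves `v` and `u` of
the block. Bob reads `u` as the difference of the two registers and `v` by a Hadamard transform, and
then computes the parity himself. -/
theorem superdenseProtocol_outputProb (hdec : ∀ i, dec (code i) = i) (x : X)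
    (y : Fin q × (Fin n ⊕ Fin n → Bool)) :
    1 ≤ (superdenseProtocol E code dec).outputProb x y (blockParity E (x, y))
      (sharedState n l) := by
  obtain ⟨i, y⟩ := y
  set v : Fin n → Bool := fun k => E x i (.inl k) with hv
  set u : Fin n → Bool := fun k => E x i (.inr k) with hu
  have hbob (a : Fin n → Bool) (m : Fin l → Bool) (b : Fin n → Bool) :
      applyBob (permUnitary (xorSnd fun _ => code i)).1 (sharedState n l) (a, b, m) =
        if b = a ∧ m = code i then uniformAmp (Fin n) else 0 := by
    rw [applyBob_eq_mulVec, permUnitary_mulVec]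
    refine if_congr (and_congr_right' ((bitXor_eq_iff _ _ _).trans ?_)) rfl rfl
    rw [show bitXor (fun _ => false) (code i) = code i by funext k; simp [bitXor]]
  simp only [superdenseProtocol, CommProtocol.outputProb, Equiv.refl_symm, Equiv.refl_apply,
    Equiv.prodComm_symm, Equiv.prodComm_apply, Prod.swap_prod_mk]
  set ψ₁ : ((Fin n → Bool) × (Fin l → Bool)) × (Fin n → Bool) → ℂ := fun s =>
    applyBob (permUnitary (xorSnd fun _ => code i)).1 (sharedState n l) (s.1.1, s.2, s.1.2)
  have halice (m : Fin l → Bool) (b a : Fin n → Bool) :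
      applyAlice (monomialUnitary (xorFst fun m k => E x (dec m) (.inr k))
        (fun s => bitSign (bitDot (fun k => E x (dec s.2) (.inl k))
          (bitXor s.1 fun k => E x (dec s.2) (.inr k)))) fun _ => bitSign_mul_star _).1
        ψ₁ ((a, m), b) =
      if m = code i ∧ b = bitXor a u then uniformAmp (Fin n) * bitSign (bitDot v b) else 0 := by
    rw [applyAlice_eq_mulVec, monomialUnitary_mulVec]
    refine (congrArg _ (hbob (bitXor a fun k => E x (dec m) (.inr k)) m b)).trans ?_
    by_cases hm : m = code i
    · subst hm
      simp only [hdec, true_and, and_true, ← hu, ← hv]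
      split_ifs with hb
      · rw [hb, mul_comm]
      · simp
    · simp [hm]
  set ψ₂ : (Fin l → Bool) × ((Fin n → Bool) × (Fin n → Bool)) → ℂ := fun s =>
    applyAlice (monomialUnitary (xorFst fun m k => E x (dec m) (.inr k))
      (fun s => bitSign (bitDot (fun k => E x (dec s.2) (.inl k))
        (bitXor s.1 fun k => E x (dec s.2) (.inr k)))) fun _ => bitSign_mul_star _).1
      ψ₁ ((s.2.2, s.1), s.2.1)
  have hfinal : applyBob (factorUnitary (Equiv.refl _) (hadamard (Fin n)) *
      permUnitary (xorSnd id) : Matrix.unitaryGroup ((Fin n → Bool) × (Fin n → Bool)) ℂ).1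
        ψ₂ (code i, v, u) = 1 := by
    rw [applyBob_eq_mulVec, Submonoid.coe_mul, ← Matrix.mulVec_mulVec, factorUnitary_mulVec]
    simp only [permUnitary_mulVec]
    have hterm (b : Fin n → Bool) : ψ₂ (code i, xorSnd id (b, u)) =
        uniformAmp (Fin n) * bitSign (bitDot v b) := by
      refine (halice (code i) b (bitXor u b)).trans (if_pos ⟨rfl, ?_⟩)
      rw [bitXor_comm u b, bitXor_bitXor]
    calc _ = ∑ b, (hadamard (Fin n)).1 v b * (uniformAmp (Fin n) * bitSign (bitDot v b)) :=
          sum_congr rfl fun b _ => congrArg _ (hterm b)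
      _ = 1 := by rw [sum_hadamard_mul_bitSign, if_pos rfl]
  have hout : bitDot (Sum.elim v u) y = blockParity E (x, (i, y)) := by
    rw [blockParity]
    congr 1
    funext k
    cases k <;> rfl
  -- This one outcome already carries all the probability.
  refine le_trans ?_ (single_le_sum (fun s _ => ?_) (mem_univ (code i, v, u)))
  · rw [if_pos hout]
    change 1 ≤ ‖applyBob _ ψ₂ _‖ ^ 2
    rw [hfinal]
    simp
  · split_ifs <;> positivity

end Superdense

theorem Qcc_blockParity_le {X : Type u} {q n l : ℕ} [NeZero q] (hl : q ≤ 2 ^ l)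
    (E : X → Fin q → Fin n ⊕ Fin n → Bool) :
    Qcc 0 (blockParity E) ≤ ((l + n : ℕ) : ℕ∞) := by
  obtain ⟨code⟩ : Nonempty (Fin q ↪ (Fin l → Bool)) :=
    Function.Embedding.nonempty_of_card_le (by simpa using hl)
  refine sInf_le ⟨_, _, _, _, sharedState n l,
    superdenseProtocol E code (Function.invFun code), sharedState_isPureState n l, rfl,
    fun x y => ?_⟩
  rw [sub_zero]
  exact superdenseProtocol_outputProb E code _ (Function.leftInverse_invFun code.injective) x y

/-! ### Choice of the encoding and the final estimate -/

/-- A finite set of suitable size can be embedded into a finite type such that the image contains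
a given small set. -/
theorem exists_injective_extending {X : Type u} [Fintype X] {β γ : Type} [Fintype β] [Fintype γ]
    (g : β → γ) (hg : Function.Injective g) (h1 : Fintype.card β ≤ Fintype.card X)
    (h2 : Fintype.card X ≤ Fintype.card γ) :
    ∃ (E : X → γ) (c : β → X), Function.Injective E ∧ Function.Injective c ∧
      ∀ b, E (c b) = g b := by
  classical
  obtain ⟨S, hS, hcard⟩ := exists_superset_card_eq (s := univ.image g) (n := Fintype.card X)
    (by rwa [card_image_of_injective _ hg, card_univ]) h2
  have e : X ≃ S := Fintype.equivOfCardEq (by simp [hcard])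
  have hmem (b : β) : g b ∈ S := hS (mem_image_of_mem g (mem_univ b))
  refine ⟨fun x => e x, fun b => e.symm ⟨g b, hmem b⟩,
    Subtype.val_injective.comp e.injective, fun b b' h => ?_, fun b => by simp⟩
  exact hg (congrArg Subtype.val (e.symm.injective h))

theorem exists_blockParity {X : Type u} [Fintype X] [DecidableEq X] {q n : ℕ} [NeZero q]
    [NeZero n] (h1 : 2 ^ q ≤ Fintype.card X) (h2 : Fintype.card X ≤ 2 ^ (2 * n * q)) :
    ∃ E : X → Fin q → Fin n ⊕ Fin n → Bool, Qoip 0 (blockParity E) = (q : ℕ∞) := by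
  -- The cube for the lower bound: bit `i` is a single coordinate of block `i`, and all else is
  -- zero.
  let g : (Fin q → Bool) → Fin q → Fin n ⊕ Fin n → Bool :=
    fun b i => Function.update (fun _ => false) (.inl 0) (b i)
  have hg : Function.Injective g := fun b b' h => funext fun i => by
    simpa [g] using congrFun₂ h i (.inl 0)
  obtain ⟨E, c, hE, hc, hEc⟩ := exists_injective_extending (X := X) g hg (by simpa using h1)
    (by simpa [← pow_mul, two_mul] using h2)
  have : Nonempty X := ⟨c fun _ => false⟩
  refine ⟨E, le_antisymm (Qoip_blockParity_le E hE) (le_Qoip_of_cube _ c hc ?_)⟩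
  rintro ⟨i, y⟩
  have hval (b : Fin q → Bool) :
      blockParity E (c b, (i, y)) = if b i && y (.inl 0) then 1 else 0 := by
    simp only [blockParity, hEc, bitDot]
    rw [Fintype.sum_eq_single (.inl 0) fun k hk => by simp [g, hk]]
    simp [g]
  by_cases hy : y (.inl 0)
  · exact .inl ⟨i, fun b => by simp [hval, hy]⟩
  · exact .inr fun b => by simp [hval, hy]

theorem mainTheorem8 :
    ∃ C : ℝ, ∀ (X : Type*) [Fintype X] [DecidableEq X] (q : ℕ),
      0 < q → (q : ℝ) ≤ Real.logb 2 (Fintype.card X) →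
      ∃ (Y : Type) (_ : Fintype Y) (_ : DecidableEq Y) (f : X × Y → Fin 2),
        Qoip 0 f = (q : ℕ∞) ∧
        ∃ c : ℕ, Qcc 0 f = (c : ℕ∞) ∧
          (q : ℝ) * (c : ℝ) ≤
            1 / 2 * Real.logb 2 (Fintype.card X) + C * max 1 ((q : ℝ) * Real.logb 2 q) := by
  -- The excess is at most `q + q * (log q + 1)`, and `q ≤ q * log q` once `q ≥ 2`, whence the
  -- constant 3.
  refine ⟨3, fun X _ _ q hq hqX => ?_⟩
  have : NeZero q := ⟨hq.ne'⟩
  have hq' : (0 : ℝ) < q := by exact_mod_cast hq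
  set L := Real.logb 2 (Fintype.card X) with hL
  have hLpos : 0 < L := hq'.trans_le hqX
  have hcard : (0 : ℝ) < Fintype.card X := by
    rcases Nat.eq_zero_or_pos (Fintype.card X) with h | h
    · simp [hL, h] at hLpos
    · exact_mod_cast h
  -- The least `n` for which `q` blocks of `2 * n` bits can encode `X`; rounding up costs at most
  -- `q` in `q * n`.
  set n := ⌈L / (2 * q)⌉₊ with hn
  have : NeZero n := ⟨(Nat.ceil_pos.2 (by positivity)).ne'⟩
  have hn1 : L ≤ n * (2 * q) := (div_le_iff₀ (by positivity)).1 (Nat.le_ceil _)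
  have hn2 : q * n ≤ 1 / 2 * L + q := by
    have h := (Nat.ceil_lt_add_one (a := L / (2 * q)) (by positivity)).le
    calc (q : ℝ) * n ≤ q * (L / (2 * q) + 1) := by gcongr
      _ = 1 / 2 * L + q := by field_simp
  have h1 : 2 ^ q ≤ Fintype.card X := by
    rw [Real.le_logb_iff_rpow_le one_lt_two hcard, Real.rpow_natCast] at hqX
    exact_mod_cast hqX
  have h2 : Fintype.card X ≤ 2 ^ (2 * n * q) := by
    have h : L ≤ (2 * n * q : ℕ) := by push_cast; linarith
    rw [hL, Real.logb_le_iff_le_rpow one_lt_two hcard, Real.rpow_natCast] at h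
    exact_mod_cast h
  obtain ⟨E, hE⟩ := exists_blockParity h1 h2
  have hQ := Qcc_blockParity_le (Nat.le_pow_clog one_lt_two q) E
  refine ⟨_, inferInstance, inferInstance, blockParity E, hE, ?_⟩
  obtain ⟨c, hc⟩ := ENat.ne_top_iff_exists.1 (ne_top_of_le_ne_top (ENat.natCast_ne_top _) hQ)
  rw [← hc] at hQ ⊢
  refine ⟨c, rfl, ?_⟩
  have hcn : (c : ℝ) ≤ Nat.clog 2 q + n := by
    have : c ≤ Nat.clog 2 q + n := by exact_mod_cast hQ
    exact_mod_cast this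
  have hqc : (q : ℝ) * c ≤ q * Nat.clog 2 q + (1 / 2 * L + q) :=
    (mul_le_mul_of_nonneg_left hcn hq'.le).trans (by rw [mul_add]; gcongr)
  -- For `q = 1` the logarithm vanishes, and the `1` in the maximum absorbs the rounding.
  rcases (Nat.succ_le_of_lt hq).eq_or_lt with rfl | hq2
  · norm_num at hqc ⊢
    linarith
  · have hlog : 1 ≤ Real.logb 2 q := by
      rw [Real.le_logb_iff_rpow_le one_lt_two hq', Real.rpow_one]
      exact_mod_cast hq2
    have hclog : (Nat.clog 2 q : ℝ) ≤ Real.logb 2 q + 1 := by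
      rw [← Real.natCeil_logb_natCast]
      exact (Nat.ceil_lt_add_one (by push_cast; linarith)).le
    have hmax := le_max_right 1 ((q : ℝ) * Real.logb 2 q)
    nlinarith [mul_le_mul_of_nonneg_left hclog hq'.le, mul_le_mul_of_nonneg_left hlog hq'.le]
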